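/- Let $n\ge 1$, let $\mathcal E$ be a complex Hilbert space and $\mathcal H$ an infinite-dimensional complex Hilbert space, and let $$[B(\mathcal H)^n]_1:=\{X=(X_1,\dots,X_n)\in B(\mathcal H)^n:\ \|X_1X_1^*+\cdots+X_nX_n^*\|^{1/2}<1\}.$$ For a word $\alpha=g_{i_1}\cdots g_{i_k}$ in the free unital semigroup $\mathbb F_n^+$ on $g_1,\dots,g_n$, put $|\alpha|=k$ and $X_\alpha:=X_{i_1}\cdots X_{i_k}$ (with $X_\alpha=I$ for the empty word). A map $f:[B(\mathcal H)^n]_1\to B(\mathcal E\otimes\mathcal H)$ is called *free holomorphic* (with coefficients in $B(\mathcal E)$) if there are $A_{(\alpha)}\in B(\mathcal E)$, $\alpha\in\mathbb F_n^+$, with $\limsup_{k\to\infty}\big\|\sum_{|\alpha|=k}A_{(\alpha)}^*A_{(\alpha)}\big\|^{1/2k}\le 1$ and $$f(X)=\sum_{k=0}^\infty\ \sum_{|\alpha|=k}A_{(\alpha)}\otimes X_\alpha\qquad (X\in[B(\mathcal H)^n]_1),$$ where the series in $k$ converges in the operator norm; $\widetilde f:=\sum_\alpha A_{(\alpha)}\otimes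 Z_\alpha$ denotes the associated formal power series in noncommuting indeterminates $Z_1,\dots,Z_n$ with coefficients in $B(\mathcal E)$. Let $[H_0^\infty]_{\le 1}$ be the set of all free holomorphic $f$ with $f(0)=0$ that are bounded with $\|f\|_\infty:=\sup_{X\in[B(\mathcal H)^n]_1}\|f(X)\|\le 1$, and let $Hol_0^+$ be the set of all free holomorphic $g$ with $g(0)=0$ and $$g(X)^*+I+g(X)\ge 0\qquad\text{for all }X\in[B(\mathcal H)^n]_1.$$ **Theorem.** For every $f\in[H_0^\infty]_{\le 1}$ the series $\widetilde f$ has constant term $0$ (so that $1-\widetilde f$ is invertible in the ring of formal power series), and the formal power series $(1-\widetilde f)^{-1}\widetilde f$ is the series of a free holomorphic function $\mathcal C(f)$ on $[B(\mathcal H)^n]_1$. The map $f\mapsto\mathcal C(f)$ (the noncommutative Cayley transform) is a bijection from $[H_0^\infty]_{\le 1}$ onto $Hol_0^+$. -/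

import Mathlib

open scoped TensorProduct

noncomputable section

/-! ### Formal power series in noncommuting indeterminates -/

/-- Formal power series `∑ A_α Z_α` in `n` noncommuting indeterminates with coefficients in `R`:
a family of coefficients indexed by the words `α` in `n` letters, that is by the elements of the
free semigroup with unit on `n` generators. -/
@[ext]
structure NCPowerSeries (n : ℕ) (R : Type*) where
  /-- the coefficient at a word -/
  coeff : List (Fin n) → R

namespace NCPowerSeries

variable {n : ℕ} {R : Type*} [Ring R]

instance : Zero (NCPowerSeries n R) := ⟨⟨fun _ => 0⟩⟩

instance : One (NCPowerSeries n R) := ⟨⟨fun w => if w = [] then 1 else 0⟩⟩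

instance : Add (NCPowerSeries n R) := ⟨fun f g => ⟨fun w => f.coeff w + g.coeff w⟩⟩

instance : Neg (NCPowerSeries n R) := ⟨fun f => ⟨fun w => -f.coeff w⟩⟩

/-- The product of formal power series: the coefficient of `f * g` at the word `α` is the sum of
`f_β * g_γ` over all factorizations `α = β γ`. -/
instance : Mul (NCPowerSeries n R) :=
  ⟨fun f g => ⟨fun w =>
    ∑ i ∈ Finset.range (w.length + 1), f.coeff (w.take i) * g.coeff (w.drop i)⟩⟩

@[simp]
theorem coeff_zero (w : List (Fin n)) : (0 : NCPowerSeries n R).coeff w = 0 := rfl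

theorem coeff_one (w : List (Fin n)) :
    (1 : NCPowerSeries n R).coeff w = if w = [] then 1 else 0 := rfl

@[simp]
theorem coeff_add (f g : NCPowerSeries n R) (w : List (Fin n)) :
    (f + g).coeff w = f.coeff w + g.coeff w := rfl

@[simp]
theorem coeff_neg (f : NCPowerSeries n R) (w : List (Fin n)) :
    (-f).coeff w = -f.coeff w := rfl

theorem coeff_mul (f g : NCPowerSeries n R) (w : List (Fin n)) : (f * g).coeff w =
    ∑ i ∈ Finset.range (w.length + 1), f.coeff (w.take i) * g.coeff (w.drop i) := rfl

theorem coeff_mul_nil (f g : NCPowerSeries n R) :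
    (f * g).coeff [] = f.coeff [] * g.coeff [] := by
  simp [coeff_mul]

theorem coeff_mul_cons (f g : NCPowerSeries n R) (a : Fin n) (w : List (Fin n)) :
    (f * g).coeff (a :: w) = f.coeff [] * g.coeff (a :: w) +
      ((⟨fun v => f.coeff (a :: v)⟩ : NCPowerSeries n R) * g).coeff w := by
  rw [coeff_mul, coeff_mul, List.length_cons, Finset.sum_range_succ', add_comm]
  simp

theorem coeff_mul_assoc (w : List (Fin n)) :
    ∀ f g h : NCPowerSeries n R, (f * g * h).coeff w = (f * (g * h)).coeff w := by
  induction w with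
  | nil => intro f g h; simp [coeff_mul_nil, mul_assoc]
  | cons a w ih =>
    intro f g h
    have key : (⟨fun v => (f * g).coeff (a :: v)⟩ : NCPowerSeries n R) =
        ⟨fun v => f.coeff [] * g.coeff (a :: v)⟩ +
          (⟨fun v => f.coeff (a :: v)⟩ : NCPowerSeries n R) * g := by
      ext v; exact coeff_mul_cons f g a v
    have dist : ∀ p q : NCPowerSeries n R,
        ((p + q) * h).coeff w = (p * h).coeff w + (q * h).coeff w := by
      intro p q; simp [coeff_mul, add_mul, Finset.sum_add_distrib]
    have smul : ((⟨fun v => f.coeff [] * g.coeff (a :: v)⟩ : NCPowerSeries n R) * h).coeff w =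
        f.coeff [] * ((⟨fun v => g.coeff (a :: v)⟩ : NCPowerSeries n R) * h).coeff w := by
      simp [coeff_mul, Finset.mul_sum, mul_assoc]
    rw [coeff_mul_cons (f * g) h, key, dist, smul, ih, coeff_mul_cons f (g * h),
      coeff_mul_cons g h, coeff_mul_nil]
    rw [mul_add, mul_assoc, add_assoc]

instance : Ring (NCPowerSeries n R) := Ring.ofMinimalAxioms
  (fun f g h => by ext w; simp [add_assoc])
  (fun f => by ext w; simp)
  (fun f => by ext w; simp)
  (fun f g h => by ext w; exact coeff_mul_assoc w f g h)
  (fun f => by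
    ext w
    rw [coeff_mul, Finset.sum_eq_single 0]
    · simp [coeff_one]
    · intro i hi h0
      have : w.take i ≠ [] := by
        intro h
        rcases List.take_eq_nil_iff.1 h with h | h
        · exact h0 h
        · subst h; simp at hi; exact h0 hi
      simp [coeff_one, this]
    · intro h; simp at h)
  (fun f => by
    ext w
    rw [coeff_mul, Finset.sum_eq_single w.length]
    · simp [coeff_one]
    · intro i hi h0
      have : w.drop i ≠ [] := by
        intro h
        have := List.drop_eq_nil_iff.1 h
        have := Finset.mem_range.1 hi
        omega
      simp [coeff_one, this]
    · intro h; simp at h)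
  (fun f g h => by ext w; simp [coeff_mul, mul_add, Finset.sum_add_distrib])
  (fun f g h => by ext w; simp [coeff_mul, add_mul, Finset.sum_add_distrib])

@[simp]
theorem coeff_sub (f g : NCPowerSeries n R) (w : List (Fin n)) :
    (f - g).coeff w = f.coeff w - g.coeff w := by
  rw [sub_eq_add_neg, coeff_add, coeff_neg, sub_eq_add_neg]

theorem coeff_pow_of_length_lt {f : NCPowerSeries n R} (hf : f.coeff [] = 0) (m : ℕ) :
    ∀ w : List (Fin n), w.length < m → (f ^ m).coeff w = 0 := by
  induction m with
  | zero => intro w hw; simp at hw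
  | succ m ih =>
    intro w hw
    rw [pow_succ', coeff_mul]
    refine Finset.sum_eq_zero fun i hi => ?_
    rcases Nat.eq_zero_or_pos i with rfl | hi0
    · simp [hf]
    · rcases Nat.eq_zero_or_pos w.length with h0 | h0
      · rw [List.length_eq_zero_iff.1 h0]; simp [hf]
      · rw [ih (w.drop i) (by rw [List.length_drop]; omega), mul_zero]

theorem coeff_mul_congr {f f' g g' : NCPowerSeries n R} {w : List (Fin n)}
    (hf : ∀ v : List (Fin n), v.length ≤ w.length → f.coeff v = f'.coeff v)
    (hg : ∀ v : List (Fin n), v.length ≤ w.length → g.coeff v = g'.coeff v) :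
    (f * g).coeff w = (f' * g').coeff w := by
  rw [coeff_mul, coeff_mul]
  refine Finset.sum_congr rfl fun i _ => ?_
  rw [hf _ (by simp), hg _ (by simp)]

/-- The series `1 + f + f ^ 2 + ⋯`, for `f` with constant term `0`: since `f ^ j` has no
coefficients at words of length less than `j`, the coefficient at `α` is that of the finite sum
`1 + f + ⋯ + f ^ |α|`. -/
def geom (f : NCPowerSeries n R) : NCPowerSeries n R :=
  ⟨fun w => (∑ j ∈ Finset.range (w.length + 1), f ^ j).coeff w⟩

theorem coeff_geom {f : NCPowerSeries n R} (hf : f.coeff [] = 0) {m : ℕ} (w : List (Fin n))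
    (hw : w.length < m) : (geom f).coeff w = (∑ j ∈ Finset.range m, f ^ j).coeff w := by
  induction m, hw using Nat.le_induction with
  | base => rfl
  | succ m hm ih =>
    rw [Finset.sum_range_succ, coeff_add, coeff_pow_of_length_lt hf m w hm, add_zero, ih]

theorem one_sub_mul_geom {f : NCPowerSeries n R} (hf : f.coeff [] = 0) :
    (1 - f) * geom f = 1 := by
  ext w
  rw [coeff_mul_congr (f' := 1 - f) (g' := ∑ j ∈ Finset.range (w.length + 1), f ^ j)
    (fun _ _ => rfl) (fun v hv => coeff_geom hf v (by omega)), mul_neg_geom_sum, coeff_sub,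
    coeff_pow_of_length_lt hf _ w (by omega), sub_zero]

theorem geom_mul_one_sub {f : NCPowerSeries n R} (hf : f.coeff [] = 0) :
    geom f * (1 - f) = 1 := by
  ext w
  rw [coeff_mul_congr (f' := ∑ j ∈ Finset.range (w.length + 1), f ^ j) (g' := 1 - f)
    (fun v hv => coeff_geom hf v (by omega)) (fun _ _ => rfl), geom_sum_mul_neg, coeff_sub,
    coeff_pow_of_length_lt hf _ w (by omega), sub_zero]

/-- If `f` has constant term `0`, then `1 - f` is invertible, so that `Ring.inverse (1 - f)` is
its genuine inverse. -/
theorem isUnit_one_sub {f : NCPowerSeries n R} (hf : f.coeff [] = 0) : IsUnit (1 - f) :=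
  ⟨⟨1 - f, geom f, one_sub_mul_geom hf, geom_mul_one_sub hf⟩, rfl⟩

theorem inverse_one_sub {f : NCPowerSeries n R} (hf : f.coeff [] = 0) :
    Ring.inverse (1 - f) = geom f :=
  Ring.inverse_unit ⟨1 - f, geom f, one_sub_mul_geom hf, geom_mul_one_sub hf⟩

/-- The Cayley transform `f ↦ (1 - f)⁻¹ f` of formal power series (used for series with constant
term `0`, for which `1 - f` is invertible). -/
def cayley (f : NCPowerSeries n R) : NCPowerSeries n R := Ring.inverse (1 - f) * f

end NCPowerSeries

/-! ### Free holomorphic functions on the noncommutative ball -/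

/-- The Hilbert space tensor product of `E` and `H`: the completion of the algebraic tensor
product with `⟪a ⊗ b, c ⊗ d⟫ = ⟪a, c⟫ * ⟪b, d⟫`. -/
def HilbertTensor (E H : Type*) [NormedAddCommGroup E] [InnerProductSpace ℂ E]
    [NormedAddCommGroup H] [InnerProductSpace ℂ H] : Type _ :=
  UniformSpace.Completion (E ⊗[ℂ] H)

namespace HilbertTensor

variable {E H : Type*} [NormedAddCommGroup E] [InnerProductSpace ℂ E]
  [NormedAddCommGroup H] [InnerProductSpace ℂ H]

instance : NormedAddCommGroup (HilbertTensor E H) :=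
  inferInstanceAs (NormedAddCommGroup (UniformSpace.Completion (E ⊗[ℂ] H)))

instance : InnerProductSpace ℂ (HilbertTensor E H) :=
  inferInstanceAs (InnerProductSpace ℂ (UniformSpace.Completion (E ⊗[ℂ] H)))

instance : CompleteSpace (HilbertTensor E H) :=
  inferInstanceAs (CompleteSpace (UniformSpace.Completion (E ⊗[ℂ] H)))

variable (E H) in
/-- The isometric embedding of the algebraic tensor product. -/
def of : E ⊗[ℂ] H →ₗᵢ[ℂ] HilbertTensor E H :=
  (UniformSpace.Completion.toComplₗᵢ : E ⊗[ℂ] H →ₗᵢ[ℂ] UniformSpace.Completion (E ⊗[ℂ] H))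

theorem denseRange_of : DenseRange (of E H) :=
  UniformSpace.Completion.denseRange_coe (α := E ⊗[ℂ] H)

end HilbertTensor

/-- The operator `A ⊗ X` on the Hilbert space tensor product: the continuous extension of
`a ⊗ x ↦ A a ⊗ X x`. -/
def opTensor {E H : Type*} [NormedAddCommGroup E] [InnerProductSpace ℂ E]
    [NormedAddCommGroup H] [InnerProductSpace ℂ H] (A : E →L[ℂ] E) (X : H →L[ℂ] H) :
    HilbertTensor E H →L[ℂ] HilbertTensor E H :=
  ((HilbertTensor.of E H).toContinuousLinearMap ∘L TensorProduct.mapL A X).extend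
    (HilbertTensor.of E H).toContinuousLinearMap

theorem opTensor_of {E H : Type*} [NormedAddCommGroup E] [InnerProductSpace ℂ E]
    [NormedAddCommGroup H] [InnerProductSpace ℂ H] (A : E →L[ℂ] E) (X : H →L[ℂ] H)
    (t : E ⊗[ℂ] H) :
    opTensor A X (HilbertTensor.of E H t) = HilbertTensor.of E H (TensorProduct.mapL A X t) := by
  have h1 : DenseRange (HilbertTensor.of E H).toContinuousLinearMap := HilbertTensor.denseRange_of
  have h2 : IsUniformInducing (HilbertTensor.of E H).toContinuousLinearMap :=
    (HilbertTensor.of E H).isometry.isUniformInducing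
  have h := ContinuousLinearMap.extend_eq
    ((HilbertTensor.of E H).toContinuousLinearMap ∘L TensorProduct.mapL A X) h1 h2 t
  exact h

/-- The open noncommutative unit ball `[B(H)ⁿ]₁`: the `n`-tuples of bounded operators with
`‖X₁X₁* + ⋯ + XₙXₙ*‖^{1/2} < 1`. -/
def ncBall (n : ℕ) (H : Type*) [NormedAddCommGroup H] [InnerProductSpace ℂ H] [CompleteSpace H] :
    Set (Fin n → (H →L[ℂ] H)) :=
  {X | Real.sqrt ‖∑ i, X i * star (X i)‖ < 1}

theorem zero_mem_ncBall (n : ℕ) (H : Type*) [NormedAddCommGroup H] [InnerProductSpace ℂ H]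
    [CompleteSpace H] : (0 : Fin n → (H →L[ℂ] H)) ∈ ncBall n H := by
  simp [ncBall]

namespace FreeHol

variable {n : ℕ} {E H : Type*} [NormedAddCommGroup E] [InnerProductSpace ℂ E] [CompleteSpace E]
  [NormedAddCommGroup H] [InnerProductSpace ℂ H] [CompleteSpace H]

/-- The radius of convergence `R ∈ [0, ∞]` of a formal power series with coefficients in `B(E)`:
`1 / R = limsup_k ‖∑_{|α| = k} A_α* A_α‖^{1 / (2k)}`. The words of length `k` are listed by the
maps `Fin k → Fin n`. -/
def radius (A : NCPowerSeries n (E →L[ℂ] E)) : ENNReal :=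
  (Filter.limsup (fun k : ℕ =>
    ‖∑ w : Fin k → Fin n, star (A.coeff (List.ofFn w)) * A.coeff (List.ofFn w)‖ₑ ^ (1 / (2 * (k : ℝ))))
    Filter.atTop)⁻¹

/-- The homogeneous part `∑_{|α| = k} A_α ⊗ X_α` of degree `k` of the series, evaluated at `X`,
where `X_α = X_{i₁} ⋯ X_{i_k}` for `α = g_{i₁} ⋯ g_{i_k}`. -/
def homogeneousPart (A : NCPowerSeries n (E →L[ℂ] E)) (k : ℕ) (X : Fin n → (H →L[ℂ] H)) :
    HilbertTensor E H →L[ℂ] HilbertTensor E H :=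
  ∑ w : Fin k → Fin n, opTensor (A.coeff (List.ofFn w)) ((List.ofFn w).map X).prod

/-- `F` is the free holomorphic function on `[B(H)ⁿ]₁` given by the formal power series
`∑ A_α ⊗ Z_α`: the series has radius of convergence at least `1`, and
`F(X) = ∑_{k ≥ 0} ∑_{|α| = k} A_α ⊗ X_α`, with convergence in the operator norm,
for all `X` in the ball. -/
def HasExpansion (F : ncBall n H → (HilbertTensor E H →L[ℂ] HilbertTensor E H))
    (A : NCPowerSeries n (E →L[ℂ] E)) : Prop :=
  1 ≤ radius A ∧ ∀ X : ncBall n H, Filter.Tendsto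
    (fun N : ℕ => ∑ k ∈ Finset.range N, homogeneousPart A k X.1) Filter.atTop (nhds (F X))

/-- The free holomorphic functions on `[B(H)ⁿ]₁` with coefficients in `B(E)`. -/
def Hol (n : ℕ) (E H : Type*) [NormedAddCommGroup E] [InnerProductSpace ℂ E] [CompleteSpace E]
    [NormedAddCommGroup H] [InnerProductSpace ℂ H] [CompleteSpace H] :
    Set (ncBall n H → (HilbertTensor E H →L[ℂ] HilbertTensor E H)) :=
  {F | ∃ A, HasExpansion F A}

/-- `H^∞`: the bounded free holomorphic functions. -/
def HInfty (n : ℕ) (E H : Type*) [NormedAddCommGroup E] [InnerProductSpace ℂ E] [CompleteSpace E]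
    [NormedAddCommGroup H] [InnerProductSpace ℂ H] [CompleteSpace H] :
    Set (ncBall n H → (HilbertTensor E H →L[ℂ] HilbertTensor E H)) :=
  {F | F ∈ Hol n E H ∧ BddAbove (Set.range fun X => ‖F X‖)}

/-- `‖F‖_∞ = sup ‖F(X)‖` over the ball (meaningful for bounded `F`). -/
def supNorm (F : ncBall n H → (HilbertTensor E H →L[ℂ] HilbertTensor E H)) : ℝ :=
  ⨆ X, ‖F X‖

/-- The closed unit ball of `H₀^∞ = {f ∈ H^∞ : f(0) = 0}`. -/
def unitBallHInftyZero (n : ℕ) (E H : Type*) [NormedAddCommGroup E] [InnerProductSpace ℂ E]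
    [CompleteSpace E] [NormedAddCommGroup H] [InnerProductSpace ℂ H] [CompleteSpace H] :
    Set (ncBall n H → (HilbertTensor E H →L[ℂ] HilbertTensor E H)) :=
  {f | f ∈ HInfty n E H ∧ f ⟨0, zero_mem_ncBall n H⟩ = 0 ∧ supNorm f ≤ 1}

/-- `Hol₀⁺`: the free holomorphic `g` with `g(0) = 0` and `g(X)* + I + g(X) ≥ 0` on the ball. -/
def HolZeroPos (n : ℕ) (E H : Type*) [NormedAddCommGroup E] [InnerProductSpace ℂ E]
    [CompleteSpace E] [NormedAddCommGroup H] [InnerProductSpace ℂ H] [CompleteSpace H] :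
    Set (ncBall n H → (HilbertTensor E H →L[ℂ] HilbertTensor E H)) :=
  {g | g ∈ Hol n E H ∧ g ⟨0, zero_mem_ncBall n H⟩ = 0 ∧
    ∀ X, (star (g X) + 1 + g X).IsPositive}

open Classical in
/-- A formal power series representing `F` (the zero series if there is none). -/
def series (F : ncBall n H → (HilbertTensor E H →L[ℂ] HilbertTensor E H)) :
    NCPowerSeries n (E →L[ℂ] E) :=
  if h : ∃ A, HasExpansion F A then h.choose else 0

/-- The function defined on the ball by a formal power series (where the series converges). -/
def eval (A : NCPowerSeries n (E →L[ℂ] E)) :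
    ncBall n H → (HilbertTensor E H →L[ℂ] HilbertTensor E H) :=
  fun X => Filter.limUnder Filter.atTop
    (fun N : ℕ => ∑ k ∈ Finset.range N, homogeneousPart A k X.1)

/-- The noncommutative Cayley transform `f ↦ (1 - f)⁻¹ f` of free holomorphic functions: the
function defined by the Cayley transform of the formal power series of `f`. -/
def cayley (f : ncBall n H → (HilbertTensor E H →L[ℂ] HilbertTensor E H)) :
    ncBall n H → (HilbertTensor E H →L[ℂ] HilbertTensor E H) :=
  eval (NCPowerSeries.cayley (series f))

end FreeHol

end

noncomputable section

/-! ### Rows and columns of operators -/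

namespace ContinuousLinearMap

variable {K : Type*} [NormedAddCommGroup K] [InnerProductSpace ℂ K] [CompleteSpace K]
  {ι : Type*}

/-! Let `A` be the series of `f` and `B` its Cayley transform, so `1 + B` is the inverse of `1 - A`.
Evaluation is multiplicative where series converge absolutely (`value_mul`), so the values `a`, `b`
at a point satisfy `a (1 + b) = b` with `1 + b` invertible. Hence `‖a‖ ≤ 1` iff `‖b x‖ ≤ ‖x + b x‖`
for all `x`, which after squaring says `b* + 1 + b ≥ 0`
(`isPositive_star_add_one_add_iff_norm_le_one`). On formal series the transform is inverted by `A =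
1 - (1 + B)⁻¹`.

What remains is convergence: a formally computed series must have radius at least `1`. It is tested
on truncated creation operators scaled by `r < 1`, which exist because `H` is infinite-dimensional.
They lie in the ball and are nilpotent, so every formal series can be evaluated there. Applied to
the vacuum, the value displays the coefficients along orthogonal vectors, so bounds uniform in the
truncation control the radius (`one_le_radius_of_norm_value_shift_le`); the same vectors show that
the coefficients are unique. From `A` to `B`, the bound comes from the Schwarz lemma, `‖a‖ ≤ √r`,
and `b = a + a b`; from `B` to `A`, positivity gives `‖a‖ ≤ 1` at once. -/

theorem norm_sum_mul_le (s : Finset ι) (P Q : ι → K →L[ℂ] K) {a b : ℝ} (ha : 0 ≤ a) (hb : 0 ≤ b)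
    (hP : ∀ y, ∑ i ∈ s, ‖star (P i) y‖ ^ 2 ≤ a ^ 2 * ‖y‖ ^ 2)
    (hQ : ∀ x, ∑ i ∈ s, ‖Q i x‖ ^ 2 ≤ b ^ 2 * ‖x‖ ^ 2) :
    ‖∑ i ∈ s, P i * Q i‖ ≤ a * b := by
  have key : ∀ x y, ‖inner ℂ y ((∑ i ∈ s, P i * Q i) x)‖ ≤ (a * b * ‖x‖) * ‖y‖ := by
    intro x y
    have h1 : inner ℂ y ((∑ i ∈ s, P i * Q i) x) = ∑ i ∈ s, inner ℂ (star (P i) y) (Q i x) := by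
      rw [sum_apply, inner_sum]
      refine Finset.sum_congr rfl fun i _ => ?_
      rw [star_eq_adjoint, adjoint_inner_left]; rfl
    rw [h1]
    calc ‖∑ i ∈ s, inner ℂ (star (P i) y) (Q i x)‖
        ≤ ∑ i ∈ s, ‖star (P i) y‖ * ‖Q i x‖ :=
          (norm_sum_le _ _).trans (Finset.sum_le_sum fun i _ => norm_inner_le_norm _ _)
      _ ≤ √(∑ i ∈ s, ‖star (P i) y‖ ^ 2) * √(∑ i ∈ s, ‖Q i x‖ ^ 2) :=
          Real.sum_mul_le_sqrt_mul_sqrt _ _ _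
      _ ≤ √((a * ‖y‖) ^ 2) * √((b * ‖x‖) ^ 2) := by
          rw [mul_pow, mul_pow]
          exact mul_le_mul (Real.sqrt_le_sqrt (hP y)) (Real.sqrt_le_sqrt (hQ x))
            (Real.sqrt_nonneg _) (Real.sqrt_nonneg _)
      _ = (a * b * ‖x‖) * ‖y‖ := by
          rw [Real.sqrt_sq (by positivity), Real.sqrt_sq (by positivity)]; ring
  refine opNorm_le_bound _ (by positivity) fun x => ?_
  rcases eq_or_ne ((∑ i ∈ s, P i * Q i) x) 0 with h | h
  · rw [h, norm_zero]; positivity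
  · have := key x ((∑ i ∈ s, P i * Q i) x)
    rw [inner_self_eq_norm_sq_to_K, norm_pow, RCLike.norm_ofReal, abs_norm, sq] at this
    exact le_of_mul_le_mul_right this (norm_pos_iff.2 h)

theorem sum_norm_sq_apply (s : Finset ι) (Q : ι → K →L[ℂ] K) (x : K) :
    ((∑ i ∈ s, ‖Q i x‖ ^ 2 : ℝ) : ℂ) = inner ℂ x ((∑ i ∈ s, star (Q i) * Q i) x) := by
  rw [sum_apply, inner_sum]
  push_cast
  refine Finset.sum_congr rfl fun i _ => ?_
  rw [Function.comp_apply, star_eq_adjoint, adjoint_inner_right, inner_self_eq_norm_sq_to_K]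
  rfl

theorem sum_norm_sq_apply_le (s : Finset ι) (Q : ι → K →L[ℂ] K) (x : K) :
    ∑ i ∈ s, ‖Q i x‖ ^ 2 ≤ ‖∑ i ∈ s, star (Q i) * Q i‖ * ‖x‖ ^ 2 := by
  have h0 : 0 ≤ ∑ i ∈ s, ‖Q i x‖ ^ 2 := by positivity
  have := congrArg norm (sum_norm_sq_apply s Q x)
  rw [Complex.norm_real, Real.norm_of_nonneg h0] at this
  rw [this]
  calc _ ≤ ‖x‖ * (‖∑ i ∈ s, star (Q i) * Q i‖ * ‖x‖) :=
        (norm_inner_le_norm _ _).trans (by gcongr; exact le_opNorm _ _)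
    _ = _ := by ring

/-- Converse to `sum_norm_sq_apply_le`: the two pass between `‖∑ Q* Q‖` and vectorwise bounds on the
column `Q`. -/
theorem norm_sum_star_mul_le (s : Finset ι) (Q : ι → K →L[ℂ] K) {b : ℝ} (hb : 0 ≤ b)
    (hQ : ∀ x, ∑ i ∈ s, ‖Q i x‖ ^ 2 ≤ b ^ 2 * ‖x‖ ^ 2) :
    ‖∑ i ∈ s, star (Q i) * Q i‖ ≤ b ^ 2 := by
  rw [sq]
  exact norm_sum_mul_le s (fun i => star (Q i)) Q hb hb (by simpa using hQ) hQ

end ContinuousLinearMap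

/-! ### Tensor products of operators -/

namespace HilbertTensor

variable {E H : Type*} [NormedAddCommGroup E] [InnerProductSpace ℂ E]
  [NormedAddCommGroup H] [InnerProductSpace ℂ H]

theorem clm_ext {K : Type*} [NormedAddCommGroup K] [InnerProductSpace ℂ K]
    {S T : HilbertTensor E H →L[ℂ] K}
    (h : ∀ e x, S (of E H (e ⊗ₜ x)) = T (of E H (e ⊗ₜ x))) : S = T := by
  have h2 : ∀ t, S (of E H t) = T (of E H t) := by
    intro t
    induction t with
    | zero => simp
    | tmul e x => exact h e x
    | add a b ha hb => simp [map_add, ha, hb]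
  exact ContinuousLinearMap.ext fun z => congrFun
    (denseRange_of.equalizer S.continuous T.continuous (funext h2)) z

theorem norm_sq_sum_orthonormal {ι : Type*} {v : ι → H} (hv : Orthonormal ℂ v) (s : Finset ι)
    (a : ι → E) : ‖of E H (∑ i ∈ s, a i ⊗ₜ v i)‖ ^ 2 = ∑ i ∈ s, ‖a i‖ ^ 2 := by
  classical
  rw [LinearIsometry.norm_map]
  have h : (inner ℂ (∑ i ∈ s, a i ⊗ₜ[ℂ] v i) (∑ i ∈ s, a i ⊗ₜ[ℂ] v i) : ℂ)
      = ((∑ i ∈ s, ‖a i‖ ^ 2 : ℝ) : ℂ) := by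
    rw [sum_inner]
    push_cast
    refine Finset.sum_congr rfl fun i hi => ?_
    rw [inner_sum, Finset.sum_eq_single i]
    · rw [TensorProduct.inner_tmul, inner_self_eq_norm_sq_to_K, inner_self_eq_norm_sq_to_K,
        hv.1 i]
      simp
    · intro j _ hj
      rw [TensorProduct.inner_tmul, hv.2 hj.symm, mul_zero]
    · intro h; exact absurd hi h
  have h' := (inner_self_eq_norm_sq_to_K (𝕜 := ℂ) (∑ i ∈ s, a i ⊗ₜ[ℂ] v i)).symm.trans h
  exact Complex.ofReal_injective ((Complex.ofReal_pow _ _).trans h')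

end HilbertTensor

section OpTensor

open HilbertTensor

variable {E H : Type*} [NormedAddCommGroup E] [InnerProductSpace ℂ E]
  [NormedAddCommGroup H] [InnerProductSpace ℂ H]

theorem opTensor_of_tmul (A : E →L[ℂ] E) (X : H →L[ℂ] H) (e : E) (x : H) :
    opTensor A X (of E H (e ⊗ₜ x)) = of E H (A e ⊗ₜ X x) := by
  rw [opTensor_of, TensorProduct.mapL_tmul]

theorem opTensor_mul (A B : E →L[ℂ] E) (X Y : H →L[ℂ] H) :
    opTensor (A * B) (X * Y) = opTensor A X * opTensor B Y :=
  clm_ext fun e x => by simp [opTensor_of_tmul]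

theorem opTensor_one : opTensor (1 : E →L[ℂ] E) (1 : H →L[ℂ] H) = 1 :=
  clm_ext fun e x => by simp [opTensor_of_tmul]

theorem opTensor_zero_left (X : H →L[ℂ] H) : opTensor (0 : E →L[ℂ] E) X = 0 :=
  clm_ext fun e x => by simp [opTensor_of_tmul]

theorem opTensor_zero_right (A : E →L[ℂ] E) : opTensor A (0 : H →L[ℂ] H) = 0 :=
  clm_ext fun e x => by simp [opTensor_of_tmul]

theorem opTensor_add_left (A B : E →L[ℂ] E) (X : H →L[ℂ] H) :
    opTensor (A + B) X = opTensor A X + opTensor B X :=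
  clm_ext fun e x => by simp [opTensor_of_tmul, TensorProduct.add_tmul]

theorem opTensor_neg_left (A : E →L[ℂ] E) (X : H →L[ℂ] H) :
    opTensor (-A) X = -opTensor A X :=
  clm_ext fun e x => by simp [opTensor_of_tmul, TensorProduct.neg_tmul]

theorem opTensor_add_right (A : E →L[ℂ] E) (X Y : H →L[ℂ] H) :
    opTensor A (X + Y) = opTensor A X + opTensor A Y :=
  clm_ext fun e x => by simp [opTensor_of_tmul, TensorProduct.tmul_add]

theorem opTensor_smul_right (A : E →L[ℂ] E) (c : ℂ) (X : H →L[ℂ] H) :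
    opTensor A (c • X) = c • opTensor A X :=
  clm_ext fun e x => by simp [opTensor_of_tmul]

theorem opTensor_sum_left {ι : Type*} (s : Finset ι) (A : ι → E →L[ℂ] E) (X : H →L[ℂ] H) :
    opTensor (∑ i ∈ s, A i) X = ∑ i ∈ s, opTensor (A i) X :=
  map_sum (⟨⟨fun A => opTensor A X, opTensor_zero_left X⟩,
    fun A B => opTensor_add_left A B X⟩ : (E →L[ℂ] E) →+ _) A s

theorem opTensor_sum_right {ι : Type*} (s : Finset ι) (A : E →L[ℂ] E) (X : ι → H →L[ℂ] H) :
    opTensor A (∑ i ∈ s, X i) = ∑ i ∈ s, opTensor A (X i) :=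
  map_sum (⟨⟨fun X => opTensor A X, opTensor_zero_right A⟩,
    fun X Y => opTensor_add_right A X Y⟩ : (H →L[ℂ] H) →+ _) X s

theorem norm_opTensor_le (A : E →L[ℂ] E) (X : H →L[ℂ] H) :
    ‖opTensor A X‖ ≤ ‖A‖ * ‖X‖ := by
  refine ContinuousLinearMap.opNorm_le_bound _ (by positivity) fun z => ?_
  induction z using denseRange_of.induction_on with
  | hp => exact isClosed_le (by fun_prop) (by fun_prop)
  | ih t =>
    rw [opTensor_of, LinearIsometry.norm_map, LinearIsometry.norm_map]
    exact ((TensorProduct.mapL A X).le_opNorm t).trans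
      (by gcongr; exact TensorProduct.norm_mapL_le A X)

theorem star_opTensor [CompleteSpace E] [CompleteSpace H] (A : E →L[ℂ] E) (X : H →L[ℂ] H) :
    star (opTensor A X) = opTensor (star A) (star X) := by
  rw [ContinuousLinearMap.star_eq_adjoint, eq_comm, ContinuousLinearMap.eq_adjoint_iff]
  have h1 : ∀ (e : E) (x : H) (f : E) (y : H),
      inner ℂ (opTensor (star A) (star X) (of E H (e ⊗ₜ x))) (of E H (f ⊗ₜ y)) =
      inner ℂ (of E H (e ⊗ₜ x)) (opTensor A X (of E H (f ⊗ₜ y))) := by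
    intro e x f y
    simp only [opTensor_of_tmul, LinearIsometry.inner_map_map, TensorProduct.inner_tmul,
      ContinuousLinearMap.star_eq_adjoint, ContinuousLinearMap.adjoint_inner_left]
  have h2 : ∀ s t : E ⊗[ℂ] H,
      inner ℂ (opTensor (star A) (star X) (of E H s)) (of E H t) =
      inner ℂ (of E H s) (opTensor A X (of E H t)) := by
    intro s t
    induction s with
    | zero => simp
    | add a b ha hb => simp only [map_add, inner_add_left, ha, hb]
    | tmul e x =>
      induction t with
      | zero => simp
      | add a b ha hb => simp only [map_add, inner_add_right, ha, hb]
      | tmul f y => exact h1 e x f y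
  intro z w
  induction z using denseRange_of.induction_on with
  | hp => exact isClosed_eq (by fun_prop) (by fun_prop)
  | ih s =>
    induction w using denseRange_of.induction_on with
    | hp => exact isClosed_eq (by fun_prop) (by fun_prop)
    | ih t => exact h2 s t

end OpTensor

end

noncomputable section

/-! ### Evaluation of formal power series -/

namespace FreeHol

open ContinuousLinearMap

variable {n : ℕ} {E H : Type*} [NormedAddCommGroup E] [InnerProductSpace ℂ E]
  [NormedAddCommGroup H] [InnerProductSpace ℂ H]

theorem homogeneousPart_add (A B : NCPowerSeries n (E →L[ℂ] E)) (k : ℕ)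
    (X : Fin n → H →L[ℂ] H) :
    homogeneousPart (A + B) k X = homogeneousPart A k X + homogeneousPart B k X := by
  simp [homogeneousPart, opTensor_add_left, Finset.sum_add_distrib]

theorem homogeneousPart_neg (A : NCPowerSeries n (E →L[ℂ] E)) (k : ℕ)
    (X : Fin n → H →L[ℂ] H) : homogeneousPart (-A) k X = -homogeneousPart A k X := by
  simp [homogeneousPart, opTensor_neg_left]

theorem homogeneousPart_smul (A : NCPowerSeries n (E →L[ℂ] E)) (k : ℕ) (c : ℂ)
    (X : Fin n → H →L[ℂ] H) : homogeneousPart A k (c • X) = c ^ k • homogeneousPart A k X := by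
  rw [homogeneousPart, homogeneousPart, Finset.smul_sum]
  have h : ∀ l : List (Fin n), (l.map (c • X)).prod = c ^ l.length • (l.map X).prod := by
    intro l
    induction l with
    | nil => simp
    | cons a l ih =>
      rw [List.map_cons, List.prod_cons, ih, List.map_cons, List.prod_cons, Pi.smul_apply,
        smul_mul_smul_comm, List.length_cons, pow_succ']
  refine Finset.sum_congr rfl fun w _ => ?_
  rw [h, opTensor_smul_right, List.length_ofFn]

theorem homogeneousPart_one_zero (X : Fin n → H →L[ℂ] H) :
    homogeneousPart (1 : NCPowerSeries n (E →L[ℂ] E)) 0 X = 1 := by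
  simp [homogeneousPart, NCPowerSeries.coeff_one, opTensor_one]

theorem homogeneousPart_one_of_ne_zero {k : ℕ} (hk : k ≠ 0) (X : Fin n → H →L[ℂ] H) :
    homogeneousPart (1 : NCPowerSeries n (E →L[ℂ] E)) k X = 0 := by
  simp [homogeneousPart, NCPowerSeries.coeff_one, opTensor_zero_left, hk]

/-- For each `i + j = k`, cutting after `i` letters identifies words of length `k` with pairs of
words of lengths `i` and `j`. The value of a product thus becomes a Cauchy product. -/
theorem homogeneousPart_mul (A B : NCPowerSeries n (E →L[ℂ] E)) (k : ℕ)
    (X : Fin n → H →L[ℂ] H) :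
    homogeneousPart (A * B) k X = ∑ p ∈ Finset.HasAntidiagonal.antidiagonal k,
      homogeneousPart A p.1 X * homogeneousPart B p.2 X := by
  have h1 : homogeneousPart (A * B) k X = ∑ p ∈ Finset.HasAntidiagonal.antidiagonal k,
      ∑ w : Fin k → Fin n,
        opTensor (A.coeff ((List.ofFn w).take p.1) * B.coeff ((List.ofFn w).drop p.1))
          ((List.ofFn w).map X).prod := by
    rw [Finset.sum_comm, homogeneousPart]
    refine Finset.sum_congr rfl fun w _ => ?_
    rw [NCPowerSeries.coeff_mul, List.length_ofFn, opTensor_sum_left,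
      Finset.Nat.sum_antidiagonal_eq_sum_range_succ_mk]
  rw [h1]
  refine Finset.sum_congr rfl fun p hp => ?_
  obtain ⟨i, j⟩ := p
  obtain rfl : i + j = k := by simpa using hp
  rw [← Equiv.sum_comp (Fin.appendEquiv i j), Fintype.sum_prod_type, homogeneousPart,
    homogeneousPart, Finset.sum_mul_sum]
  refine Finset.sum_congr rfl fun u _ => Finset.sum_congr rfl fun v _ => ?_
  have h2 : List.ofFn (Fin.appendEquiv i j (u, v)) = List.ofFn u ++ List.ofFn v :=
    List.ofFn_fin_append u v
  rw [h2, List.map_append, List.prod_append, opTensor_mul]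
  simp

/-- The value of a formal power series at a tuple of operators. -/
def value (A : NCPowerSeries n (E →L[ℂ] E)) (X : Fin n → H →L[ℂ] H) :
    HilbertTensor E H →L[ℂ] HilbertTensor E H :=
  ∑' k, homogeneousPart A k X

/-- Absolute convergence of the series of homogeneous parts. -/
def AbsConv (A : NCPowerSeries n (E →L[ℂ] E)) (X : Fin n → H →L[ℂ] H) : Prop :=
  Summable fun k => ‖homogeneousPart A k X‖

theorem AbsConv.add {A B : NCPowerSeries n (E →L[ℂ] E)} {X : Fin n → H →L[ℂ] H}
    (hA : AbsConv A X) (hB : AbsConv B X) : AbsConv (A + B) X := by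
  refine Summable.of_nonneg_of_le (fun _ => norm_nonneg _) (fun k => ?_) (Summable.add hA hB)
  rw [homogeneousPart_add]
  exact norm_add_le _ _

theorem AbsConv.neg {A : NCPowerSeries n (E →L[ℂ] E)} {X : Fin n → H →L[ℂ] H}
    (hA : AbsConv A X) : AbsConv (-A) X := by
  simpa [AbsConv, homogeneousPart_neg] using hA

theorem AbsConv.one {X : Fin n → H →L[ℂ] H} :
    AbsConv (1 : NCPowerSeries n (E →L[ℂ] E)) X :=
  summable_of_ne_finset_zero (s := {0}) fun k hk => by
    rw [homogeneousPart_one_of_ne_zero (by simpa using hk), norm_zero]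

theorem value_add {A B : NCPowerSeries n (E →L[ℂ] E)} {X : Fin n → H →L[ℂ] H}
    (hA : AbsConv A X) (hB : AbsConv B X) : value (A + B) X = value A X + value B X := by
  simp only [value, homogeneousPart_add]
  exact hA.of_norm.tsum_add hB.of_norm

theorem value_neg (A : NCPowerSeries n (E →L[ℂ] E)) (X : Fin n → H →L[ℂ] H) :
    value (-A) X = -value A X := by
  simp only [value, homogeneousPart_neg]
  exact tsum_neg

theorem value_zero (A : NCPowerSeries n (E →L[ℂ] E)) :
    value A (0 : Fin n → H →L[ℂ] H) = opTensor (A.coeff []) 1 := by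
  rw [value, tsum_eq_single 0]
  · simp [homogeneousPart]
  · intro k hk
    have := homogeneousPart_smul A k 0 (0 : Fin n → H →L[ℂ] H)
    rwa [zero_smul, zero_pow hk, zero_smul] at this

theorem value_one (X : Fin n → H →L[ℂ] H) :
    value (1 : NCPowerSeries n (E →L[ℂ] E)) X = 1 := by
  rw [value, tsum_eq_single 0 fun k hk => homogeneousPart_one_of_ne_zero hk X,
    homogeneousPart_one_zero]

theorem value_mul {A B : NCPowerSeries n (E →L[ℂ] E)} {X : Fin n → H →L[ℂ] H}
    (hA : AbsConv A X) (hB : AbsConv B X) : value (A * B) X = value A X * value B X := by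
  rw [value, value, value, tsum_mul_tsum_eq_tsum_sum_antidiagonal_of_summable_norm hA hB]
  simp only [homogeneousPart_mul]

theorem value_one_sub {A : NCPowerSeries n (E →L[ℂ] E)} {X : Fin n → H →L[ℂ] H}
    (hA : AbsConv A X) : value (1 - A) X = 1 - value A X := by
  rw [sub_eq_add_neg, value_add AbsConv.one hA.neg, value_one, value_neg, sub_eq_add_neg]

theorem AbsConv.tendsto {A : NCPowerSeries n (E →L[ℂ] E)} {X : Fin n → H →L[ℂ] H}
    (hA : AbsConv A X) : Filter.Tendsto
      (fun N : ℕ => ∑ k ∈ Finset.range N, homogeneousPart A k X) Filter.atTop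
      (nhds (value A X)) :=
  hA.of_norm.hasSum.tendsto_sum_nat

variable [CompleteSpace E] [CompleteSpace H]

/-! ### Estimates for homogeneous parts -/

/-- Peel off the first letter: `(X_i X_w)* y = X_w* (X_i* y)`, so each degree contributes one factor
`r ^ 2`. -/
theorem sum_norm_sq_star_word_le {X : Fin n → H →L[ℂ] H} {r : ℝ}
    (hX : ∀ y, ∑ i, ‖star (X i) y‖ ^ 2 ≤ r ^ 2 * ‖y‖ ^ 2) (k : ℕ) (y : H) :
    ∑ w : Fin k → Fin n, ‖star ((List.ofFn w).map X).prod y‖ ^ 2 ≤ (r ^ k) ^ 2 * ‖y‖ ^ 2 := by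
  induction k generalizing y with
  | zero => simp
  | succ k ih =>
    rw [← Equiv.sum_comp (Fin.consEquiv fun _ => Fin n), Fintype.sum_prod_type]
    calc _ = ∑ i : Fin n, ∑ w : Fin k → Fin n,
          ‖star ((List.ofFn w).map X).prod (star (X i) y)‖ ^ 2 := by
          simp [Fin.consEquiv, List.ofFn_succ]
      _ ≤ ∑ i : Fin n, (r ^ k) ^ 2 * ‖star (X i) y‖ ^ 2 := Finset.sum_le_sum fun i _ => ih _
      _ = (r ^ k) ^ 2 * ∑ i : Fin n, ‖star (X i) y‖ ^ 2 := by rw [Finset.mul_sum]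
      _ ≤ (r ^ k) ^ 2 * (r ^ 2 * ‖y‖ ^ 2) := by gcongr; exact hX y
      _ = _ := by ring

/-- The norm of the row `[X₁, …, Xₙ]`. -/
def rowNorm (X : Fin n → H →L[ℂ] H) : ℝ := √‖∑ i, X i * star (X i)‖

theorem rowNorm_nonneg (X : Fin n → H →L[ℂ] H) : 0 ≤ rowNorm X := Real.sqrt_nonneg _

theorem sum_norm_sq_star_le (X : Fin n → H →L[ℂ] H) (y : H) :
    ∑ i, ‖star (X i) y‖ ^ 2 ≤ rowNorm X ^ 2 * ‖y‖ ^ 2 := by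
  have := sum_norm_sq_apply_le Finset.univ (fun i => star (X i)) y
  rw [rowNorm, Real.sq_sqrt (norm_nonneg _)]
  simpa using this

theorem rowNorm_le {X : Fin n → H →L[ℂ] H} {r : ℝ} (hr : 0 ≤ r)
    (hX : ∀ y, ∑ i, ‖star (X i) y‖ ^ 2 ≤ r ^ 2 * ‖y‖ ^ 2) : rowNorm X ≤ r := by
  have := norm_sum_star_mul_le Finset.univ (fun i => star (X i)) hr hX
  rw [rowNorm]
  exact Real.sqrt_le_iff.2 ⟨hr, by simpa using this⟩

theorem rowNorm_smul (c : ℂ) (X : Fin n → H →L[ℂ] H) : rowNorm (c • X) = ‖c‖ * rowNorm X := by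
  have : ∑ i, (c • X) i * star ((c • X) i) = (c * star c) • ∑ i, X i * star (X i) := by
    rw [Finset.smul_sum]
    refine Finset.sum_congr rfl fun i _ => ?_
    rw [Pi.smul_apply, star_smul, smul_mul_smul_comm]
  rw [rowNorm, this, norm_smul, norm_mul, norm_star, Real.sqrt_mul (by positivity),
    Real.sqrt_mul_self (norm_nonneg _), rowNorm]

/-- Factor `A_w ⊗ X_w = (1 ⊗ X_w)(A_w ⊗ 1)`; the sum is then a row times a column, to which
Cauchy–Schwarz applies. -/
theorem norm_homogeneousPart_le (A : NCPowerSeries n (E →L[ℂ] E)) (k : ℕ)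
    (X : Fin n → H →L[ℂ] H) :
    ‖homogeneousPart A k X‖ ≤
      √‖∑ w : Fin k → Fin n, star (A.coeff (List.ofFn w)) * A.coeff (List.ofFn w)‖ *
        rowNorm X ^ k := by
  have h1 : homogeneousPart A k X = ∑ w : Fin k → Fin n,
      opTensor (1 : E →L[ℂ] E) ((List.ofFn w).map X).prod *
        opTensor (A.coeff (List.ofFn w)) (1 : H →L[ℂ] H) :=
    Finset.sum_congr rfl fun w _ => by rw [← opTensor_mul, one_mul, mul_one]
  rw [h1, mul_comm (√_)]
  have hrow := rowNorm_nonneg X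
  refine norm_sum_mul_le _ _ _ (by positivity) (Real.sqrt_nonneg _) (fun y => ?_) fun y => ?_
  · refine (sum_norm_sq_apply_le _ _ _).trans ?_
    gcongr
    have h2 : ∑ w : Fin k → Fin n,
        star (star (opTensor (1 : E →L[ℂ] E) ((List.ofFn w).map X).prod)) *
          star (opTensor (1 : E →L[ℂ] E) ((List.ofFn w).map X).prod) =
        opTensor (1 : E →L[ℂ] E) (∑ w : Fin k → Fin n, star (star ((List.ofFn w).map X).prod) *
          star ((List.ofFn w).map X).prod) := by
      rw [opTensor_sum_right]
      refine Finset.sum_congr rfl fun w _ => ?_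
      rw [star_star, star_star, star_opTensor, ← opTensor_mul, star_one, one_mul]
    rw [h2]
    refine (norm_opTensor_le _ _).trans ?_
    refine (mul_le_of_le_one_left (norm_nonneg _) norm_id_le).trans ?_
    exact norm_sum_star_mul_le _ _ (by positivity)
      (sum_norm_sq_star_word_le (sum_norm_sq_star_le X) k)
  · refine (sum_norm_sq_apply_le _ _ _).trans ?_
    rw [Real.sq_sqrt (norm_nonneg _)]
    gcongr
    have h2 : ∑ w : Fin k → Fin n,
        star (opTensor (A.coeff (List.ofFn w)) (1 : H →L[ℂ] H)) *
          opTensor (A.coeff (List.ofFn w)) (1 : H →L[ℂ] H) =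
        opTensor (∑ w : Fin k → Fin n, star (A.coeff (List.ofFn w)) * A.coeff (List.ofFn w))
          (1 : H →L[ℂ] H) := by
      rw [opTensor_sum_left]
      refine Finset.sum_congr rfl fun w _ => ?_
      rw [star_opTensor, ← opTensor_mul, star_one, one_mul]
    rw [h2]
    exact (norm_opTensor_le _ _).trans (mul_le_of_le_one_right (norm_nonneg _) norm_id_le)

/-! ### The radius of convergence -/

/-- The square of the norm of the column of the coefficients of degree `k`. -/
def colSq (A : NCPowerSeries n (E →L[ℂ] E)) (k : ℕ) : ℝ :=
  ‖∑ w : Fin k → Fin n, star (A.coeff (List.ofFn w)) * A.coeff (List.ofFn w)‖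

theorem enorm_rpow_le_iff (A : NCPowerSeries n (E →L[ℂ] E)) {k : ℕ} (hk : k ≠ 0) {s : ℝ}
    (hs : 0 ≤ s) :
    ‖∑ w : Fin k → Fin n, star (A.coeff (List.ofFn w)) * A.coeff (List.ofFn w)‖ₑ
      ^ (1 / (2 * (k : ℝ))) ≤ ENNReal.ofReal s ↔ colSq A k ≤ (s ^ k) ^ 2 := by
  have hk' : (0 : ℝ) < k := by positivity
  rw [one_div, ENNReal.rpow_inv_le_iff (by positivity),
    ENNReal.ofReal_rpow_of_nonneg hs (by positivity), ← ofReal_norm,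
    ENNReal.ofReal_le_ofReal_iff (by positivity), colSq, ← pow_mul, ← Real.rpow_natCast]
  push_cast
  rw [mul_comm 2 (k : ℝ)]

theorem one_le_radius {A : NCPowerSeries n (E →L[ℂ] E)}
    (h : ∀ r : ℝ, 0 < r → r < 1 → ∃ C : ℝ, ∀ k, (r ^ k) ^ 2 * colSq A k ≤ C ^ 2) :
    1 ≤ radius A := by
  rw [radius, ENNReal.one_le_inv]
  refine ENNReal.le_of_forall_pos_le_add fun ε hε _ => ?_
  set s : ℝ := 1 + ε with hs
  have hs1 : 1 < s := by
    have : (0 : ℝ) < ε := hε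
    linarith
  have hse : (1 : ENNReal) + ε = ENNReal.ofReal s := by
    rw [hs, ENNReal.ofReal_add zero_le_one ε.coe_nonneg, ENNReal.ofReal_one,
      ENNReal.ofReal_coe_nnreal]
  rw [hse]
  -- With `1 / s < r < 1` the product `r * s` exceeds `1`, so its powers eventually absorb the
  -- constant `C` belonging to `r`.
  obtain ⟨r, hr1, hr2⟩ := exists_between (inv_lt_one_of_one_lt₀ hs1)
  have hr0 : 0 < r := lt_trans (by positivity) hr1
  obtain ⟨C, hC⟩ := h r hr0 hr2
  have hrs : 1 < r * s := by
    rwa [inv_lt_iff_one_lt_mul₀ (by positivity)] at hr1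
  have hev : ∀ᶠ k : ℕ in Filter.atTop, |C| ≤ (r * s) ^ k :=
    (tendsto_pow_atTop_atTop_of_one_lt hrs).eventually_ge_atTop _
  refine Filter.limsup_le_of_le (by isBoundedDefault) ?_
  filter_upwards [hev, Filter.eventually_ne_atTop 0] with k hk hk0
  rw [enorm_rpow_le_iff A hk0 (by positivity)]
  have h2 : (r ^ k) ^ 2 * colSq A k ≤ (r ^ k) ^ 2 * (s ^ k) ^ 2 := by
    refine (hC k).trans ?_
    rw [← mul_pow, ← mul_pow, ← sq_abs]
    gcongr
  exact le_of_mul_le_mul_left h2 (by positivity)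

/-- The root test: for `rowNorm X < t < 1` the coefficient columns are eventually at most `t⁻¹ ^ k`,
so the terms are dominated by a geometric series of ratio `rowNorm X / t`. -/
theorem absConv_of_one_le_radius {A : NCPowerSeries n (E →L[ℂ] E)} (hA : 1 ≤ radius A)
    {X : Fin n → H →L[ℂ] H} (hX : rowNorm X < 1) : AbsConv A X := by
  obtain ⟨t, ht1, ht2⟩ := exists_between hX
  have ht0 : 0 < t := (rowNorm_nonneg X).trans_lt ht1
  have hs1 : 1 < t⁻¹ := (one_lt_inv₀ ht0).2 ht2
  rw [radius, ENNReal.one_le_inv] at hA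
  have hev := Filter.eventually_lt_of_limsup_lt
    (hA.trans_lt (ENNReal.one_lt_ofReal.2 hs1)) (by isBoundedDefault)
  have hq : rowNorm X / t < 1 := (div_lt_one ht0).2 ht1
  have hq0 : 0 ≤ rowNorm X / t := div_nonneg (rowNorm_nonneg X) ht0.le
  refine summable_of_isBigO_nat (summable_geometric_of_lt_one hq0 hq) ?_
  refine Asymptotics.IsBigO.of_bound 1 ?_
  filter_upwards [hev, Filter.eventually_ne_atTop 0] with k hk hk0
  rw [norm_norm, one_mul, Real.norm_of_nonneg (by positivity), div_pow, div_eq_inv_mul, ← inv_pow]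
  refine (norm_homogeneousPart_le A k X).trans ?_
  have := (enorm_rpow_le_iff A hk0 (inv_pos.2 ht0).le).1 hk.le
  have hrow := rowNorm_nonneg X
  gcongr
  exact Real.sqrt_le_iff.2 ⟨by positivity, this⟩

theorem colSq_le {A : NCPowerSeries n (E →L[ℂ] E)} {k : ℕ} {b : ℝ} (hb : 0 ≤ b)
    (h : ∀ e, ∑ w : Fin k → Fin n, ‖A.coeff (List.ofFn w) e‖ ^ 2 ≤ b ^ 2 * ‖e‖ ^ 2) :
    colSq A k ≤ b ^ 2 :=
  norm_sum_star_mul_le _ _ hb h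

theorem HasExpansion.eq_value {F : ncBall n H → (HilbertTensor E H →L[ℂ] HilbertTensor E H)}
    {A : NCPowerSeries n (E →L[ℂ] E)} (h : HasExpansion F A) (X : ncBall n H) :
    F X = value A X.1 :=
  tendsto_nhds_unique (h.2 X) (absConv_of_one_le_radius h.1 X.2).tendsto

theorem hasExpansion_iff {F : ncBall n H → (HilbertTensor E H →L[ℂ] HilbertTensor E H)}
    {A : NCPowerSeries n (E →L[ℂ] E)} :
    HasExpansion F A ↔ 1 ≤ radius A ∧ ∀ X : ncBall n H, F X = value A X.1 :=
  ⟨fun h => ⟨h.1, h.eq_value⟩, fun h => ⟨h.1, fun X => by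
    rw [h.2 X]; exact (absConv_of_one_le_radius h.1 X.2).tendsto⟩⟩

theorem hasExpansion_eval {A : NCPowerSeries n (E →L[ℂ] E)} (hA : 1 ≤ radius A) :
    HasExpansion (eval A : ncBall n H → _) A :=
  hasExpansion_iff.2 ⟨hA, fun X => (absConv_of_one_le_radius hA X.2).tendsto.limUnder_eq⟩

/-! ### The Schwarz lemma -/

/-- The one-variable Schwarz lemma for the operator-valued function `z ↦ value A (z • X)` on the
disc of radius `R`, read at `z = 1`. -/
theorem norm_value_le_inv {A : NCPowerSeries n (E →L[ℂ] E)} (hA : 1 ≤ radius A)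
    (h0 : A.coeff [] = 0) (hb : ∀ X : ncBall n H, ‖value A X.1‖ ≤ 1) {R : ℝ} (hR : 1 < R)
    {X : Fin n → H →L[ℂ] H} (hX : R * rowNorm X < 1) : ‖value A X‖ ≤ R⁻¹ := by
  have hR0 : 0 < R := by linarith
  have hmem : ∀ z : ℂ, ‖z‖ ≤ R → rowNorm (z • X) < 1 := fun z hz => by
    rw [rowNorm_smul]
    exact (mul_le_mul_of_nonneg_right hz (rowNorm_nonneg X)).trans_lt hX
  have hval : ∀ z : ℂ, value A (z • X) = ∑' k, z ^ k • homogeneousPart A k X := fun z => by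
    simp only [value, homogeneousPart_smul]
  have hd : DifferentiableOn ℂ (fun z : ℂ => value A (z • X)) (Metric.ball 0 R) := by
    simp only [hval]
    -- Absolute convergence at `z = R` itself dominates the terms on the whole disc.
    have hs := absConv_of_one_le_radius hA (hmem (R : ℂ) (by simp [abs_of_pos hR0]))
    refine Complex.differentiableOn_tsum_of_summable_norm hs (fun k => by fun_prop)
      Metric.isOpen_ball fun k z hz => ?_
    rw [homogeneousPart_smul, norm_smul, norm_smul, norm_pow, norm_pow, Complex.norm_real,
      Real.norm_of_nonneg hR0.le]
    gcongr
    exact (mem_ball_zero_iff.1 hz).le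
  have hz : value A ((0 : ℂ) • X) = 0 := by
    rw [hval, tsum_eq_single 0 fun k hk => by rw [zero_pow hk, zero_smul]]
    simp [homogeneousPart, h0, opTensor_zero_left]
  have := Complex.dist_le_div_mul_dist_of_mapsTo_ball (R₂ := 1) (z := 1) hd
    (fun z hz' => by
      rw [hz, mem_closedBall_zero_iff]
      exact hb ⟨z • X, hmem z ((mem_ball_zero_iff.1 hz').le)⟩) (by simpa using hR)
  simpa only [hz, dist_zero_right, one_smul, norm_one, mul_one, one_div] using this

end FreeHol

end

noncomputable section

/-! ### Truncated creation operators -/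

theorem exists_orthonormal_list {H : Type*} [NormedAddCommGroup H] [InnerProductSpace ℂ H]
    (hH : ¬ FiniteDimensional ℂ H) (n : ℕ) : ∃ v : List (Fin n) → H, Orthonormal ℂ v := by
  let b := Module.Basis.ofVectorSpace ℂ H
  have hinf : Infinite (Module.Basis.ofVectorSpaceIndex ℂ H) := by
    by_contra h
    rw [not_infinite_iff_finite] at h
    exact hH (Module.Finite.of_basis b)
  -- Gram–Schmidt needs a sequence, so an independent one is extracted and then reindexed through
  -- the encoding of words by naturals.
  have hli := b.linearIndependent.comp _ (Infinite.natEmbedding _).injective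
  exact ⟨_, (InnerProductSpace.gramSchmidtNormed_orthonormal hli).comp _
    (Encodable.encode_injective (α := List (Fin n)))⟩

namespace FreeHol

open ContinuousLinearMap HilbertTensor

section Shift

variable {n : ℕ} {H : Type*} [NormedAddCommGroup H] [InnerProductSpace ℂ H]

/-- The words of length less than `m`. -/
def shortWords (n m : ℕ) : Finset (List (Fin n)) := (List.finite_length_lt (Fin n) m).toFinset

theorem mem_shortWords {m : ℕ} {w : List (Fin n)} : w ∈ shortWords n m ↔ w.length < m := by
  simp [shortWords]

/-- The `i`-th left creation operator on the span of an orthonormal family indexed by the words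
of length at most `m`, truncated at length `m` and multiplied by `r`. -/
def shift (v : List (Fin n) → H) (m : ℕ) (r : ℝ) (i : Fin n) : H →L[ℂ] H :=
  (r : ℂ) • ∑ w ∈ shortWords n m, InnerProductSpace.rankOne ℂ (v (i :: w)) (v w)

theorem shift_apply (v : List (Fin n) → H) (m : ℕ) (r : ℝ) (i : Fin n) (x : H) :
    shift v m r i x = (r : ℂ) • ∑ w ∈ shortWords n m, inner ℂ (v w) x • v (i :: w) := by
  simp [shift, sum_apply]

variable {v : List (Fin n) → H} (hv : Orthonormal ℂ v)
include hv

theorem shift_apply_basis {m : ℕ} (r : ℝ) (i : Fin n) {w : List (Fin n)} (hw : w.length < m) :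
    shift v m r i (v w) = (r : ℂ) • v (i :: w) := by
  rw [shift_apply, Finset.sum_eq_single w]
  · rw [inner_self_eq_norm_sq_to_K, hv.1 w]; simp
  · intro u _ hu
    rw [hv.2 hu, zero_smul]
  · intro h
    exact absurd (mem_shortWords.2 hw) h

theorem prod_shift_apply_nil {m : ℕ} (r : ℝ) {w : List (Fin n)} (hw : w.length ≤ m) :
    (w.map (shift v m r)).prod (v []) = ((r ^ w.length : ℝ) : ℂ) • v w := by
  induction w with
  | nil => simp
  | cons i w ih =>
    have hw' : w.length < m := by simpa using hw
    have h1 : ((i :: w).map (shift v m r)).prod (v []) =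
        shift v m r i ((w.map (shift v m r)).prod (v [])) := by
      rw [List.map_cons, List.prod_cons]; rfl
    rw [h1, ih hw'.le, map_smul, shift_apply_basis hv r i hw', smul_smul, List.length_cons,
      pow_succ]
    push_cast
    rfl

/-- Each creation operator lengthens words by one letter, so a product of `w.length` of them leaves
no component along a shorter word. -/
theorem inner_prod_shift {m : ℕ} (r : ℝ) (x : H) (w : List (Fin n)) :
    ∀ u : List (Fin n), u.length < w.length →
      inner ℂ (v u) ((w.map (shift v m r)).prod x) = 0 := by
  induction w with
  | nil => intro u hu; simp at hu
  | cons i w ih =>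
    intro u hu
    have h1 : ((i :: w).map (shift v m r)).prod x =
        shift v m r i ((w.map (shift v m r)).prod x) := by
      rw [List.map_cons, List.prod_cons]; rfl
    rw [h1, shift_apply, inner_smul_right, inner_sum, Finset.sum_eq_zero, mul_zero]
    intro z _
    rw [inner_smul_right]
    by_cases hz : u = i :: z
    · rw [ih z (by simpa [hz] using hu), zero_mul]
    · rw [hv.2 hz, mul_zero]

/-- After `m` letters or more the range is orthogonal to all `v z` with `z.length < m`, the only
vectors on which a further `shift` is nonzero. -/
theorem prod_shift_eq_zero {m : ℕ} (r : ℝ) {w : List (Fin n)} (hw : m < w.length) :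
    (w.map (shift v m r)).prod = 0 := by
  cases w with
  | nil => simp at hw
  | cons i w =>
    ext x
    have h1 : ((i :: w).map (shift v m r)).prod x =
        shift v m r i ((w.map (shift v m r)).prod x) := by
      rw [List.map_cons, List.prod_cons]; rfl
    rw [h1, shift_apply, Finset.sum_eq_zero, smul_zero, zero_apply]
    intro z hz
    rw [mem_shortWords] at hz
    rw [List.length_cons] at hw
    rw [inner_prod_shift hv r x w z (by omega), zero_smul]

/-- The adjoints read off the coefficients of `y` along the vectors `v (i :: w)`; these words are
distinct for distinct pairs `(i, w)`, so Bessel's inequality bounds the sum. -/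
theorem sum_norm_sq_star_shift_le [CompleteSpace H] (m : ℕ) (r : ℝ) (y : H) :
    ∑ i, ‖star (shift v m r i) y‖ ^ 2 ≤ r ^ 2 * ‖y‖ ^ 2 := by
  have h1 : ∀ i, ‖star (shift v m r i) y‖ ^ 2 =
      r ^ 2 * ∑ w ∈ shortWords n m, ‖inner ℂ (v (i :: w)) y‖ ^ 2 := by
    intro i
    have h2 : star (shift v m r i) y =
        (r : ℂ) • ∑ w ∈ shortWords n m, inner ℂ (v (i :: w)) y • v w := by
      rw [shift, star_smul, star_sum, smul_apply, sum_apply]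
      simp [star_eq_adjoint]
    have h3 : (inner ℂ (∑ w ∈ shortWords n m, inner ℂ (v (i :: w)) y • v w)
        (∑ w ∈ shortWords n m, inner ℂ (v (i :: w)) y • v w) : ℂ) =
        ((∑ w ∈ shortWords n m, ‖inner ℂ (v (i :: w)) y‖ ^ 2 : ℝ) : ℂ) := by
      rw [hv.inner_sum]
      push_cast
      exact Finset.sum_congr rfl fun w _ => by rw [Complex.conj_mul']
    rw [inner_self_eq_norm_sq_to_K] at h3
    rw [h2, norm_smul, mul_pow, Complex.norm_real, Real.norm_eq_abs, sq_abs]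
    congr 1
    exact Complex.ofReal_injective ((Complex.ofReal_pow _ _).trans h3)
  simp only [h1]
  rw [← Finset.mul_sum, ← Finset.sum_product']
  gcongr
  have hinj : Function.Injective fun p : Fin n × List (Fin n) => p.1 :: p.2 := by
    rintro ⟨i, w⟩ ⟨j, u⟩ h
    simpa using h
  exact (hv.comp _ hinj).sum_inner_products_le y

theorem rowNorm_shift_le [CompleteSpace H] (m : ℕ) {r : ℝ} (hr : 0 ≤ r) :
    rowNorm (shift v m r) ≤ r :=
  rowNorm_le hr (sum_norm_sq_star_shift_le hv m r)

variable {E : Type*} [NormedAddCommGroup E] [InnerProductSpace ℂ E]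

theorem homogeneousPart_shift_eq_zero (A : NCPowerSeries n (E →L[ℂ] E)) {m k : ℕ} (r : ℝ)
    (hk : m < k) : homogeneousPart A k (shift v m r) = 0 :=
  Finset.sum_eq_zero fun w _ => by
    rw [prod_shift_eq_zero hv r (by simpa using hk), opTensor_zero_right]

theorem absConv_shift (A : NCPowerSeries n (E →L[ℂ] E)) (m : ℕ) (r : ℝ) :
    AbsConv A (shift v m r) :=
  summable_of_ne_finset_zero (s := Finset.range (m + 1)) fun k hk => by
    rw [homogeneousPart_shift_eq_zero hv A r (by simpa using hk), norm_zero]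

theorem value_shift_apply (A : NCPowerSeries n (E →L[ℂ] E)) (m : ℕ) (r : ℝ) (e : E) :
    value A (shift v m r) (of E H (e ⊗ₜ v [])) =
      of E H (∑ p ∈ (Finset.range (m + 1)).sigma fun k => (Finset.univ : Finset (Fin k → Fin n)),
        (((r ^ p.1 : ℝ) : ℂ) • A.coeff (List.ofFn p.2) e) ⊗ₜ v (List.ofFn p.2)) := by
  rw [value, tsum_eq_sum (s := Finset.range (m + 1)) fun k hk =>
    homogeneousPart_shift_eq_zero hv A r (by simpa using hk), sum_apply, Finset.sum_sigma, map_sum]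
  refine Finset.sum_congr rfl fun k hk => ?_
  rw [homogeneousPart, sum_apply, map_sum]
  refine Finset.sum_congr rfl fun w _ => ?_
  have hk' : k < m + 1 := Finset.mem_range.1 hk
  rw [opTensor_of_tmul, prod_shift_apply_nil hv r (by rw [List.length_ofFn]; omega),
    TensorProduct.smul_tmul, List.length_ofFn]

/-- On `e ⊗ v []` the value is an orthogonal sum of the `r ^ |w| A_w e ⊗ v w` with `|w| ≤ m`; keep
only the top degree. No convergence of `A` is assumed. -/
theorem sum_norm_sq_coeff_le (A : NCPowerSeries n (E →L[ℂ] E)) (m : ℕ) (r : ℝ) (e : E) :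
    (r ^ m) ^ 2 * ∑ w : Fin m → Fin n, ‖A.coeff (List.ofFn w) e‖ ^ 2 ≤
      ‖value A (shift v m r)‖ ^ 2 * ‖e‖ ^ 2 := by
  have hinj : Function.Injective fun p : Σ k, Fin k → Fin n => List.ofFn p.2 :=
    fun p q h => List.ofFn_inj'.1 h
  have h1 := norm_sq_sum_orthonormal (hv.comp _ hinj)
    ((Finset.range (m + 1)).sigma fun k => (Finset.univ : Finset (Fin k → Fin n)))
    fun p => ((r ^ p.1 : ℝ) : ℂ) • A.coeff (List.ofFn p.2) e
  simp only [Function.comp_apply] at h1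
  rw [← value_shift_apply hv] at h1
  have h2 : ‖value A (shift v m r) (of E H (e ⊗ₜ v []))‖ ≤ ‖value A (shift v m r)‖ * ‖e‖ := by
    refine (le_opNorm _ _).trans_eq ?_
    rw [LinearIsometry.norm_map, TensorProduct.norm_tmul, hv.1, mul_one]
  calc _ = ∑ w : Fin m → Fin n, ‖((r ^ m : ℝ) : ℂ) • A.coeff (List.ofFn w) e‖ ^ 2 := by
        rw [Finset.mul_sum]
        refine Finset.sum_congr rfl fun w _ => ?_
        rw [norm_smul, mul_pow, Complex.norm_real, Real.norm_eq_abs, sq_abs]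
    _ ≤ _ := by
        rw [Finset.sum_sigma] at h1
        refine le_trans ?_ (h1.symm.le.trans ?_)
        · exact Finset.single_le_sum (f := fun k => ∑ w : Fin k → Fin n,
            ‖((r ^ k : ℝ) : ℂ) • A.coeff (List.ofFn w) e‖ ^ 2)
            (fun k _ => by positivity) (Finset.self_mem_range_succ m)
        · rw [← mul_pow]
          gcongr

theorem coeff_eq_zero_of_value_shift_eq_zero {A : NCPowerSeries n (E →L[ℂ] E)} {r : ℝ}
    (hr : r ≠ 0) {w : List (Fin n)} (h : value A (shift v w.length r) = 0) : A.coeff w = 0 := by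
  ext e
  have h1 := sum_norm_sq_coeff_le hv A w.length r e
  rw [h, norm_zero, zero_pow two_ne_zero, zero_mul] at h1
  have h2 : ‖A.coeff (List.ofFn w.get) e‖ ^ 2 ≤ 0 :=
    (Finset.single_le_sum (f := fun u : Fin w.length → Fin n => ‖A.coeff (List.ofFn u) e‖ ^ 2)
      (fun _ _ => by positivity) (Finset.mem_univ w.get)).trans
      (nonpos_of_mul_nonpos_right h1 (by positivity))
  rw [List.ofFn_get] at h2
  simpa using le_antisymm h2 (by positivity)

variable [CompleteSpace E]

theorem one_le_radius_of_norm_value_shift_le {A : NCPowerSeries n (E →L[ℂ] E)}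
    (h : ∀ r : ℝ, 0 < r → r < 1 → ∃ C : ℝ, ∀ m, ‖value A (shift v m r)‖ ≤ C) : 1 ≤ radius A := by
  refine one_le_radius fun r hr0 hr1 => ?_
  obtain ⟨C, hC⟩ := h r hr0 hr1
  have hC0 : 0 ≤ C := (norm_nonneg _).trans (hC 0)
  refine ⟨C, fun k => ?_⟩
  have hr : (0 : ℝ) < r ^ k := by positivity
  have h1 : colSq A k ≤ (C / r ^ k) ^ 2 := colSq_le (by positivity) fun e => by
    rw [div_pow, div_mul_eq_mul_div, le_div_iff₀ (by positivity), mul_comm]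
    refine (sum_norm_sq_coeff_le hv A k r e).trans ?_
    gcongr
    exact hC k
  rw [div_pow, le_div_iff₀ (by positivity)] at h1
  linarith

end Shift

/-! ### Uniqueness of the coefficients -/

variable {n : ℕ} {E H : Type*} [NormedAddCommGroup E] [InnerProductSpace ℂ E] [CompleteSpace E]
  [NormedAddCommGroup H] [InnerProductSpace ℂ H] [CompleteSpace H]

theorem HasExpansion.unique (hH : ¬ FiniteDimensional ℂ H)
    {F : ncBall n H → (HilbertTensor E H →L[ℂ] HilbertTensor E H)}
    {A B : NCPowerSeries n (E →L[ℂ] E)} (hA : HasExpansion F A) (hB : HasExpansion F B) :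
    A = B := by
  obtain ⟨v, hv⟩ := exists_orthonormal_list hH n
  ext1
  funext w
  rw [← sub_eq_zero, ← NCPowerSeries.coeff_sub]
  -- Any scale in `(0, 1)` would do: it keeps the shifts inside the ball, where both series have the
  -- value of `F`.
  refine coeff_eq_zero_of_value_shift_eq_zero hv (r := 1 / 2) (by norm_num) ?_
  have hX : rowNorm (shift v w.length (1 / 2)) < 1 :=
    (rowNorm_shift_le hv _ (by norm_num)).trans_lt (by norm_num)
  rw [sub_eq_add_neg, value_add (absConv_shift hv A _ _) (absConv_shift hv B _ _).neg, value_neg,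
    ← hA.eq_value ⟨_, hX⟩, ← hB.eq_value ⟨_, hX⟩, add_neg_cancel]

theorem HasExpansion.series_eq (hH : ¬ FiniteDimensional ℂ H)
    {F : ncBall n H → (HilbertTensor E H →L[ℂ] HilbertTensor E H)}
    {A : NCPowerSeries n (E →L[ℂ] E)} (hA : HasExpansion F A) : series F = A := by
  have h : ∃ A, HasExpansion F A := ⟨A, hA⟩
  rw [series, dif_pos h]
  exact h.choose_spec.unique hH hA

theorem HasExpansion.coeff_nil_eq_zero_iff (hH : ¬ FiniteDimensional ℂ H)
    {F : ncBall n H → (HilbertTensor E H →L[ℂ] HilbertTensor E H)}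
    {A : NCPowerSeries n (E →L[ℂ] E)} (hA : HasExpansion F A) :
    F ⟨0, zero_mem_ncBall n H⟩ = 0 ↔ A.coeff [] = 0 := by
  rw [hA.eq_value, value_zero]
  refine ⟨fun h => ?_, fun h => by rw [h, opTensor_zero_left]⟩
  -- Only a unit vector of `H` is needed, to recover `A.coeff []` from its tensor product with the
  -- identity.
  obtain ⟨v, hv⟩ := exists_orthonormal_list hH n
  ext e
  have h1 := congrArg norm (congrArg (fun T => T (of E H (e ⊗ₜ v []))) h)
  simpa [opTensor_of_tmul, TensorProduct.norm_tmul, hv.1 []] using h1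

/-! ### The Cayley transform -/

/-- The quadratic form of `star b + 1 + b` at `x` is `‖x + b x‖ ^ 2 - ‖b x‖ ^ 2`. -/
theorem isPositive_star_add_one_add_iff {K : Type*} [NormedAddCommGroup K]
    [InnerProductSpace ℂ K] [CompleteSpace K] (b : K →L[ℂ] K) :
    (star b + 1 + b).IsPositive ↔ ∀ x, ‖b x‖ ≤ ‖x + b x‖ := by
  rw [isPositive_def']
  have hsa : IsSelfAdjoint (star b + 1 + b) := by
    rw [isSelfAdjoint_iff, star_add, star_add, star_star, star_one]
    abel
  have key : ∀ x, (star b + 1 + b).reApplyInnerSelf x = ‖x + b x‖ ^ 2 - ‖b x‖ ^ 2 := by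
    intro x
    have h1 : (star b + 1 + b) x = star b x + x + b x := rfl
    rw [reApplyInnerSelf_apply, h1, inner_add_left, inner_add_left, star_eq_adjoint,
      adjoint_inner_left, map_add, map_add, norm_add_sq (𝕜 := ℂ), inner_self_eq_norm_sq,
      inner_re_symm (b x) x]
    ring
  simp only [hsa, true_and, key, sub_nonneg]
  exact forall_congr' fun x => sq_le_sq₀ (norm_nonneg _) (norm_nonneg _)

/-- Since `a (x + b x) = b x` and `1 + b` is onto, the inequality `‖b x‖ ≤ ‖x + b x‖` for all `x`
says exactly that `a` is a contraction. -/
theorem isPositive_star_add_one_add_iff_norm_le_one {K : Type*} [NormedAddCommGroup K]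
    [InnerProductSpace ℂ K] [CompleteSpace K] {a b : K →L[ℂ] K} (h1 : (1 - a) * (1 + b) = 1)
    (h2 : (1 + b) * (1 - a) = 1) : (star b + 1 + b).IsPositive ↔ ‖a‖ ≤ 1 := by
  rw [isPositive_star_add_one_add_iff]
  have hab : ∀ x, a (x + b x) = b x := by
    intro x
    have h3 : a * (1 + b) = b := by
      have : a * (1 + b) = (1 + b) - (1 - a) * (1 + b) := by noncomm_ring
      rw [this, h1, add_sub_cancel_left]
    exact congrArg (fun T => T x) h3
  constructor
  · intro h
    refine opNorm_le_bound _ zero_le_one fun y => ?_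
    have hy : (1 - a) y + b ((1 - a) y) = y := congrArg (fun T => T y) h2
    have h3 := h ((1 - a) y)
    have h4 := hab ((1 - a) y)
    rw [hy] at h3 h4
    rw [← h4] at h3
    rwa [one_mul]
  · intro h x
    calc ‖b x‖ = ‖a (x + b x)‖ := by rw [hab]
      _ ≤ ‖x + b x‖ := (a.le_opNorm _).trans (mul_le_of_le_one_left (norm_nonneg _) h)

end FreeHol

/-! ### Algebra of the Cayley transform of formal power series -/

namespace NCPowerSeries

variable {n : ℕ} {R : Type*} [Ring R]

theorem one_add_cayley {A : NCPowerSeries n R} (hA : A.coeff [] = 0) :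
    1 + cayley A = geom A := by
  have h := geom_mul_one_sub hA
  rw [cayley, inverse_one_sub hA]
  rw [mul_sub, mul_one] at h
  rw [← h, sub_add_cancel]

theorem coeff_nil_cayley {A : NCPowerSeries n R} (hA : A.coeff [] = 0) :
    (cayley A).coeff [] = 0 := by
  rw [cayley, coeff_mul_nil, hA, mul_zero]

theorem cayley_injOn {A B : NCPowerSeries n R} (hA : A.coeff [] = 0) (hB : B.coeff [] = 0)
    (h : cayley A = cayley B) : A = B := by
  have h1 : geom A = geom B := by rw [← one_add_cayley hA, ← one_add_cayley hB, h]
  have h2 : 1 - A = 1 - B :=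
    left_inv_eq_right_inv (one_sub_mul_geom hA) (h1 ▸ geom_mul_one_sub hB)
  simpa using h2

theorem exists_cayley_eq {B : NCPowerSeries n R} (hB : B.coeff [] = 0) :
    ∃ A : NCPowerSeries n R, A.coeff [] = 0 ∧ cayley A = B := by
  have hB' : (-B).coeff [] = 0 := by rw [coeff_neg, hB, neg_zero]
  have h1 := one_sub_mul_geom hB'
  have h2 := geom_mul_one_sub hB'
  rw [sub_neg_eq_add] at h1 h2
  have h3 : 1 - geom (-B) = geom (-B) * B := by
    rw [mul_add, mul_one] at h2
    rw [← h2, add_sub_cancel_left]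
  -- Solving `1 + B = (1 - A)⁻¹` gives `A = 1 - (1 + B)⁻¹`, and `geom (-B)` is `(1 + B)⁻¹`.
  refine ⟨1 - geom (-B), by rw [h3, coeff_mul_nil, hB, mul_zero], ?_⟩
  rw [cayley, sub_sub_cancel, Ring.inverse_unit ⟨geom (-B), 1 + B, h2, h1⟩]
  change (1 + B) * (1 - geom (-B)) = B
  rw [mul_sub, h1, mul_one, add_sub_cancel_left]

end NCPowerSeries

/-! ### The Cayley transform of free holomorphic functions -/

namespace FreeHol

open ContinuousLinearMap HilbertTensor NCPowerSeries

variable {n : ℕ} {E H : Type*} [NormedAddCommGroup E] [InnerProductSpace ℂ E]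
  [NormedAddCommGroup H] [InnerProductSpace ℂ H]

/-- Convergence is required only at the point `X`, so this applies at the truncated shifts before
anything is known about the radii. -/
theorem one_sub_value_mul {A : NCPowerSeries n (E →L[ℂ] E)} {X : Fin n → H →L[ℂ] H}
    (h0 : A.coeff [] = 0) (hA : AbsConv A X) (hB : AbsConv (NCPowerSeries.cayley A) X) :
    (1 - value A X) * (1 + value (NCPowerSeries.cayley A) X) = 1 ∧
      (1 + value (NCPowerSeries.cayley A) X) * (1 - value A X) = 1 := by
  have hA1 : AbsConv (1 - A) X := by
    rw [sub_eq_add_neg]; exact AbsConv.one.add hA.neg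
  have hB1 := AbsConv.one.add hB
  have h1 := value_mul hA1 hB1
  have h2 := value_mul hB1 hA1
  rw [one_add_cayley h0] at h1 h2
  rw [one_sub_mul_geom h0, ← one_add_cayley h0] at h1
  rw [geom_mul_one_sub h0, ← one_add_cayley h0] at h2
  rw [value_one, value_one_sub hA, value_add AbsConv.one hB, value_one] at h1 h2
  exact ⟨h1.symm, h2.symm⟩

variable [CompleteSpace E] [CompleteSpace H]

theorem one_le_radius_cayley (hH : ¬ FiniteDimensional ℂ H) {A : NCPowerSeries n (E →L[ℂ] E)}
    (hA : 1 ≤ radius A) (h0 : A.coeff [] = 0) (hb : ∀ X : ncBall n H, ‖value A X.1‖ ≤ 1) :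
    1 ≤ radius (NCPowerSeries.cayley A) := by
  obtain ⟨v, hv⟩ := exists_orthonormal_list hH n
  refine one_le_radius_of_norm_value_shift_le hv fun r hr0 hr1 => ?_
  have hs0 : 0 < √r := Real.sqrt_pos.2 hr0
  have hs1 : √r < 1 := (Real.sqrt_lt_sqrt hr0.le hr1).trans_eq Real.sqrt_one
  -- The bound solves `‖b‖ ≤ √r + √r * ‖b‖`. The Schwarz lemma is used below with `R = 1 / √r`,
  -- admissible since `R * r = √r < 1`.
  refine ⟨√r / (1 - √r), fun m => ?_⟩
  have ha : ‖value A (shift v m r)‖ ≤ √r := by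
    have h := norm_value_le_inv hA h0 hb (R := (√r)⁻¹) ((one_lt_inv₀ hs0).2 hs1)
      (X := shift v m r) ?_
    · rwa [inv_inv] at h
    · refine (mul_le_mul_of_nonneg_left (rowNorm_shift_le hv m hr0.le) (by positivity)).trans_lt ?_
      rwa [inv_mul_eq_div, Real.div_sqrt]
  obtain ⟨h1, -⟩ := one_sub_value_mul h0 (absConv_shift hv A m r) (absConv_shift hv _ m r)
  set a := value A (shift v m r)
  set b := value (NCPowerSeries.cayley A) (shift v m r)
  have h2 : b = a + a * b := by
    have : (1 - a) * (1 + b) = 1 + b - (a + a * b) := by noncomm_ring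
    rw [this, sub_eq_iff_eq_add] at h1
    exact add_left_cancel h1
  have h3 : ‖b‖ ≤ √r + √r * ‖b‖ := by
    calc ‖b‖ = ‖a + a * b‖ := congrArg norm h2
      _ ≤ ‖a‖ + ‖a‖ * ‖b‖ := (norm_add_le _ _).trans (by gcongr; exact norm_mul_le _ _)
      _ ≤ _ := by gcongr
  rw [le_div_iff₀ (by linarith)]
  linarith

theorem one_le_radius_of_cayley_isPositive (hH : ¬ FiniteDimensional ℂ H)
    {A : NCPowerSeries n (E →L[ℂ] E)} (h0 : A.coeff [] = 0)
    (hp : ∀ X : ncBall n H, (star (value (NCPowerSeries.cayley A) X.1) + 1 +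
      value (NCPowerSeries.cayley A) X.1).IsPositive) :
    1 ≤ radius A := by
  obtain ⟨v, hv⟩ := exists_orthonormal_list hH n
  refine one_le_radius_of_norm_value_shift_le hv fun r hr0 hr1 => ⟨1, fun m => ?_⟩
  obtain ⟨h1, h2⟩ := one_sub_value_mul h0 (absConv_shift hv A m r) (absConv_shift hv _ m r)
  exact (isPositive_star_add_one_add_iff_norm_le_one h1 h2).1
    (hp ⟨_, (rowNorm_shift_le hv m hr0.le).trans_lt hr1⟩)

theorem norm_le_one_of_mem {f : ncBall n H → (HilbertTensor E H →L[ℂ] HilbertTensor E H)}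
    (hf : f ∈ unitBallHInftyZero n E H) (X : ncBall n H) : ‖f X‖ ≤ 1 :=
  (le_ciSup hf.1.2 X).trans hf.2.2

theorem hasExpansion_cayley (hH : ¬ FiniteDimensional ℂ H)
    {f : ncBall n H → (HilbertTensor E H →L[ℂ] HilbertTensor E H)}
    (hf : f ∈ unitBallHInftyZero n E H) {A : NCPowerSeries n (E →L[ℂ] E)}
    (hA : HasExpansion f A) :
    A.coeff [] = 0 ∧ HasExpansion (cayley f) (NCPowerSeries.cayley A) := by
  have h0 := (hA.coeff_nil_eq_zero_iff hH).1 hf.2.1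
  refine ⟨h0, ?_⟩
  -- Uniqueness makes the series picked by choice equal to the given `A`.
  rw [cayley, hA.series_eq hH]
  refine hasExpansion_eval (one_le_radius_cayley hH hA.1 h0 fun X => ?_)
  rw [← hA.eq_value]
  exact norm_le_one_of_mem hf X

theorem cayley_mapsTo (hH : ¬ FiniteDimensional ℂ H) :
    Set.MapsTo cayley (unitBallHInftyZero n E H) (HolZeroPos n E H) := by
  intro f hf
  obtain ⟨A, hA⟩ := hf.1.1
  obtain ⟨h0, hB⟩ := hasExpansion_cayley hH hf hA
  refine ⟨⟨_, hB⟩, (hB.coeff_nil_eq_zero_iff hH).2 (coeff_nil_cayley h0), fun X => ?_⟩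
  obtain ⟨h1, h2⟩ := one_sub_value_mul h0 (absConv_of_one_le_radius hA.1 X.2)
    (absConv_of_one_le_radius hB.1 X.2)
  rw [hB.eq_value, isPositive_star_add_one_add_iff_norm_le_one h1 h2, ← hA.eq_value]
  exact norm_le_one_of_mem hf X

theorem cayley_injOn (hH : ¬ FiniteDimensional ℂ H) :
    Set.InjOn cayley (unitBallHInftyZero n E H) := by
  intro f hf g hg hfg
  obtain ⟨A, hA⟩ := hf.1.1
  obtain ⟨B, hB⟩ := hg.1.1
  obtain ⟨hA0, hA'⟩ := hasExpansion_cayley hH hf hA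
  obtain ⟨hB0, hB'⟩ := hasExpansion_cayley hH hg hB
  rw [← hfg] at hB'
  have hAB : A = B := NCPowerSeries.cayley_injOn hA0 hB0 (hA'.unique hH hB')
  funext X
  rw [hA.eq_value, hB.eq_value, hAB]

theorem cayley_surjOn (hH : ¬ FiniteDimensional ℂ H) :
    Set.SurjOn cayley (unitBallHInftyZero n E H) (HolZeroPos n E H) := by
  rintro g ⟨⟨B, hB⟩, hg0, hpos⟩
  obtain ⟨A, h0, rfl⟩ := exists_cayley_eq ((hB.coeff_nil_eq_zero_iff hH).1 hg0)
  -- So far `A` is merely formal; positivity of `g` at the shifts is what makes it converge on the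
  -- ball.
  have hA1 : 1 ≤ radius A := one_le_radius_of_cayley_isPositive hH h0 fun X => by
    rw [← hB.eq_value]; exact hpos X
  have hA : HasExpansion (eval A : ncBall n H → _) A := hasExpansion_eval hA1
  have hle : ∀ X : ncBall n H, ‖(eval A X : HilbertTensor E H →L[ℂ] HilbertTensor E H)‖ ≤ 1 := by
    intro X
    obtain ⟨h1, h2⟩ := one_sub_value_mul h0 (absConv_of_one_le_radius hA.1 X.2)
      (absConv_of_one_le_radius hB.1 X.2)
    rw [hA.eq_value, ← isPositive_star_add_one_add_iff_norm_le_one h1 h2, ← hB.eq_value]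
    exact hpos X
  have hmem : (eval A : ncBall n H → _) ∈ unitBallHInftyZero n E H :=
    ⟨⟨⟨A, hA⟩, 1, Set.forall_mem_range.2 hle⟩, (hA.coeff_nil_eq_zero_iff hH).2 h0,
      haveI : Nonempty (ncBall n H) := ⟨⟨0, zero_mem_ncBall n H⟩⟩
      ciSup_le hle⟩
  refine ⟨_, hmem, funext fun X => ?_⟩
  rw [(hasExpansion_cayley hH hmem hA).2.eq_value, hB.eq_value]

end FreeHol

end

/-- The first conjunct says that, on the unit ball of `H₀^∞`, `FreeHol.cayley f` really is the free
holomorphic function given by the series `(1 - A)⁻¹ A`, whatever series `A` represents `f`. -/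
theorem theorem7p3 (n : ℕ) (E H : Type*)
    [NormedAddCommGroup E] [InnerProductSpace ℂ E] [CompleteSpace E]
    [NormedAddCommGroup H] [InnerProductSpace ℂ H] [CompleteSpace H]
    (hH : ¬ FiniteDimensional ℂ H) :
    (∀ f ∈ FreeHol.unitBallHInftyZero n E H, ∀ A : NCPowerSeries n (E →L[ℂ] E),
      FreeHol.HasExpansion f A →
        A.coeff [] = 0 ∧ FreeHol.HasExpansion (FreeHol.cayley f) (NCPowerSeries.cayley A)) ∧
    Set.BijOn FreeHol.cayley (FreeHol.unitBallHInftyZero n E H) (FreeHol.HolZeroPos n E H) :=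
  ⟨fun _ hf _ hA => FreeHol.hasExpansion_cayley hH hf hA,
    FreeHol.cayley_mapsTo hH, FreeHol.cayley_injOn hH, FreeHol.cayley_surjOn hH⟩
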